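/- Conventions. Let $\Sigma$ be a finite alphabet, let $\vdash$ and $\dashv$ be two further symbols (the left and right end-markers), and put $\widetilde\Sigma=\Sigma\cup\{\vdash,\dashv\}$. An *affine finite automaton* (AfA) $M$ over $\Sigma$ consists of a finite set $E$ of states, a starting state $e_s\in E$, a set $E_a\subseteq E$ of accepting states, and for each $\sigma\in\widetilde\Sigma$ a real $E\times E$ matrix $A_\sigma$ each of whose columns sums to $1$. On input $w=w_1\cdots w_k\in\Sigma^*$ its final state is the vector $v_f=A_{\dashv}A_{w_k}\cdots A_{w_1}A_{\vdash}\,e_s\in\mathbb R^E$, where $e_s$ is identified with the corresponding standard basis vector, and its accepting value is $$f_M(w)=\sum_{e\in E_a}\frac{|v_f[e]|}{\sum_{e'\in E}|v_f[e']|}.$$ A *probabilistic finite automaton* (PFA) $P$ is given by the same data, with the matrices $A_\sigma$ having in addition nonnegative entries; its accepting probability is $f_P(w)=\sum_{e\in E_a}v_f[e]$. An automaton $X$ (a PFA or an AfA) recognizes $L\subseteq\Sigma^*$ with cutpoint $\lambda\in[0,1)$ if $L=\{w\in\Sigma^*: f_X(w)>\lambda\}$. Let $\mathsf{SL}$ (the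 stochastic languages) and $\mathsf{AfL}$ (the affine languages) be the classes of all languages, over arbitrary finite alphabets, that are recognized with some cutpoint $\lambda\in[0,1)$ by some PFA, respectively by some AfA. Statement. $\mathsf{SL}\subsetneq\mathsf{AfL}$. That is, every stochastic language is an affine language, and some affine language is not stochastic. Moreover, properness is witnessed by the language $$\mathtt{LAPIN\check S}'=\{w\in\{a,b,c\}^*: |w|_a^4>|w|_b^2>|w|_c\},$$ where $|w|_\sigma$ is the number of occurrences of $\sigma$ in $w$: this language is recognized by an AfA with cutpoint $\tfrac12$, and it does not belong to $\mathsf{SL}$. -/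

import Mathlib

/-- Input symbols extended by a left and a right end-marker. -/
inductive TapeSymbol (α : Type) : Type where
  | left : TapeSymbol α
  | sym (a : α) : TapeSymbol α
  | right : TapeSymbol α

/-- The word actually read on input `w`: left end-marker, then `w`, then right end-marker. -/
def tape {α : Type} (w : List α) : List (TapeSymbol α) :=
  TapeSymbol.left :: (w.map TapeSymbol.sym ++ [TapeSymbol.right])

/-- The column vector obtained from the basis vector of `start` by applying, in order of reading,
the matrices attached to the symbols of the word `t`. -/
noncomputable def runMatrices {α E : Type} [Fintype E] [DecidableEq E]
    (A : TapeSymbol α → Matrix E E ℝ) (start : E) (t : List (TapeSymbol α)) : E → ℝ :=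
  t.foldl (fun v s => (A s).mulVec v) (Pi.single start 1)

/-- A probabilistic finite automaton with input alphabet `α` and state set `E`. Every transition
matrix is (left) stochastic: its entries are nonnegative and each column sums to one. -/
structure PFA (α E : Type) [Fintype E] [DecidableEq E] where
  trans : TapeSymbol α → Matrix E E ℝ
  trans_stochastic : ∀ s, trans s ∈ Matrix.colStochastic ℝ E
  start : E
  accept : Finset E

/-- An affine finite automaton with input alphabet `α` and state set `E`. Every transition
matrix is affine: each column sums to one, entries being arbitrary reals. -/
structure AfA (α E : Type) [Fintype E] where
  trans : TapeSymbol α → Matrix E E ℝ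
  trans_sum : ∀ s j, ∑ i, trans s i j = 1
  start : E
  accept : Finset E

namespace PFA

variable {α E : Type} [Fintype E] [DecidableEq E]

/-- The final probabilistic state on input `w`. -/
noncomputable def final (P : PFA α E) (w : List α) : E → ℝ :=
  runMatrices P.trans P.start (tape w)

/-- The accepting probability on input `w`. -/
noncomputable def acceptProb (P : PFA α E) (w : List α) : ℝ :=
  ∑ e ∈ P.accept, P.final w e

/-- `P` recognizes `L` with cutpoint `c`. -/
def RecognizesWithCutpoint (P : PFA α E) (c : ℝ) (L : Language α) : Prop :=
  ∀ w : List α, w ∈ L ↔ c < P.acceptProb w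

end PFA

namespace AfA

variable {α E : Type} [Fintype E] [DecidableEq E]

/-- The final affine state on input `w`. -/
noncomputable def final (M : AfA α E) (w : List α) : E → ℝ :=
  runMatrices M.trans M.start (tape w)

/-- The accepting value on input `w`: total weight of the accepting states in the final state.
The `ℓ¹`-norm in the denominator is at least one because the entries sum to one. -/
noncomputable def acceptValue (M : AfA α E) (w : List α) : ℝ :=
  ∑ e ∈ M.accept, |M.final w e| / ∑ i, |M.final w i|

/-- `M` recognizes `L` with cutpoint `c`. -/
def RecognizesWithCutpoint (M : AfA α E) (c : ℝ) (L : Language α) : Prop :=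
  ∀ w : List α, w ∈ L ↔ c < M.acceptValue w

end AfA

/-- A formal language together with its finite alphabet. -/
structure FormalLanguage : Type 1 where
  Alphabet : Type
  finite_alphabet : Finite Alphabet
  words : Language Alphabet

/-- The class of stochastic languages. -/
def SL : Set FormalLanguage :=
  {L | ∃ (E : Type) (_ : Fintype E) (_ : DecidableEq E) (P : PFA L.Alphabet E) (c : ℝ),
    0 ≤ c ∧ c < 1 ∧ P.RecognizesWithCutpoint c L.words}

/-- The class of affine languages. -/
def AfL : Set FormalLanguage :=
  {L | ∃ (E : Type) (_ : Fintype E) (_ : DecidableEq E) (M : AfA L.Alphabet E) (c : ℝ),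
    0 ≤ c ∧ c < 1 ∧ M.RecognizesWithCutpoint c L.words}

/-- The three-letter alphabet. -/
inductive ABC : Type where
  | a : ABC
  | b : ABC
  | c : ABC
  deriving DecidableEq

instance : Fintype ABC where
  elems := {ABC.a, ABC.b, ABC.c}
  complete x := by cases x <;> simp

/-- The words `w` over `{a, b, c}` with `|w|_a ^ 4 > |w|_b ^ 2 > |w|_c`. -/
def lapinsWords : Language ABC :=
  {w : List ABC | w.count ABC.a ^ 4 > w.count ABC.b ^ 2 ∧ w.count ABC.b ^ 2 > w.count ABC.c}

/-- The same set of words, bundled with its alphabet. -/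
def lapinsLanguage : FormalLanguage where
  Alphabet := ABC
  finite_alphabet := inferInstance
  words := lapinsWords

/-! Inclusion: on probability vectors the accepting value of an AfA is the accepting probability.
For the affine automaton, put `p = x² - y` and `q = y² - z`, where `x, y, z` count the letters; both
are positive iff `|p - q| < p + q`. This compares absolute values of entries computed linearly, and
`AfA.complete` turns arbitrary matrices into affine ones without disturbing such a comparison.

Non-stochasticity: on words `a^x b^y c^z`, accepting probability minus cutpoint is a linear
functional of `C^z B^y A^x`. Averaging over a bounded box of shifts, with nonnegative weights chosen
to kill every eigenvalue that is not a positive real, preserves the sign away from the boundary of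
the region and leaves an exponential polynomial with positive bases (`exists_pow_mul_aeval_eq`).
Along `(tξ, t²η, t⁴ζ)` its leading part is a nonzero polynomial in `η/ξ²` and `ζ/ξ⁴`
(`exists_leading_polynomial`). That polynomial would be nonnegative on `y < 1, z < y²` and
nonpositive where `y > 1` or `z > y²`; the order of vanishing along `y = 1` would be odd for `z < 1`
and even for `z > 1`, which is impossible (`not_sign_quadrants`). -/

section

open Matrix

/-! ### Affine simulation of arbitrary real matrices -/

namespace AfA

variable {α E : Type} [Fintype E]

/-- Completes arbitrary matrices to affine ones by sharing the missing weight equally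
between two additional states. -/
noncomputable def completeMatrix (T : Matrix E E ℝ) : Matrix (E ⊕ Bool) (E ⊕ Bool) ℝ :=
  Matrix.of fun i j => match i, j with
    | .inl i, .inl j => T i j
    | .inl _, .inr _ => 0
    | .inr _, .inl j => (1 - ∑ i, T i j) / 2
    | .inr _, .inr _ => 1 / 2

/-- The vector `v` together with the weight missing to `1`, shared between two states. -/
noncomputable def completeVec (v : E → ℝ) : E ⊕ Bool → ℝ :=
  Sum.elim v fun _ => (1 - ∑ i, v i) / 2

/-- The affine automaton simulating arbitrary real matrices. -/
noncomputable def complete (T : TapeSymbol α → Matrix E E ℝ) (start : E) (accept : Finset E) :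
    AfA α (E ⊕ Bool) where
  trans s := completeMatrix (T s)
  trans_sum s j := by
    cases j <;> simp [completeMatrix]; ring
  start := .inl start
  accept := accept.disjSum {true}

theorem completeMatrix_mulVec (T : Matrix E E ℝ) (v : E → ℝ) :
    completeMatrix T *ᵥ completeVec v = completeVec (T *ᵥ v) := by
  ext i
  cases i with
  | inl i => simp [completeMatrix, completeVec, mulVec, dotProduct]
  | inr b =>
    have h : ∑ i, (T *ᵥ v) i = ∑ j, (∑ i, T i j) * v j := by
      simp only [mulVec, dotProduct, Finset.sum_mul]
      exact Finset.sum_comm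
    simp only [completeVec, Sum.elim_inr, h]
    simp only [completeMatrix, mulVec, dotProduct, Fintype.sum_sum_type, of_apply, Sum.elim_inl,
      Sum.elim_inr, Fintype.sum_bool]
    have : ∀ j, (1 - ∑ i, T i j) / 2 * v j = v j / 2 - (∑ i, T i j) * v j / 2 := fun j => by ring
    simp only [this, Finset.sum_sub_distrib, ← Finset.sum_div]
    ring

variable [DecidableEq E]

theorem complete_final (T : TapeSymbol α → Matrix E E ℝ) (start : E) (accept : Finset E)
    (w : List α) :
    (complete T start accept).final w = completeVec (runMatrices T start (tape w)) := by
  have key : ∀ (t : List (TapeSymbol α)) (v : E → ℝ),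
      t.foldl (fun v s => completeMatrix (T s) *ᵥ v) (completeVec v) =
        completeVec (t.foldl (fun v s => T s *ᵥ v) v) := by
    intro t
    induction t with
    | nil => intro v; rfl
    | cons s t ih => intro v; simp only [List.foldl_cons, completeMatrix_mulVec, ih]
  have h0 : (Pi.single (.inl start) 1 : E ⊕ Bool → ℝ) = completeVec (Pi.single start 1) := by
    ext i
    cases i <;> simp [completeVec, Pi.single_apply]
  rw [final, runMatrices, runMatrices, ← key, ← h0]
  rfl

/-- Exactly one of the two padding states accepts and they carry equal weight, so the padding
cancels when the accepting value is compared with one half. -/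
theorem half_lt_complete_acceptValue_iff (T : TapeSymbol α → Matrix E E ℝ) (start : E)
    (accept : Finset E) (w : List α) :
    1 / 2 < (complete T start accept).acceptValue w ↔
      ∑ e ∈ acceptᶜ, |runMatrices T start (tape w) e| <
        ∑ e ∈ accept, |runMatrices T start (tape w) e| := by
  rw [acceptValue, complete_final, ← Finset.sum_div]
  set v := runMatrices T start (tape w)
  have hacc : ∑ e ∈ (complete T start accept).accept, |completeVec v e| =
      ∑ e ∈ accept, |v e| + |(1 - ∑ i, v i) / 2| := by
    simp [complete, completeVec, Finset.sum_disjSum]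
  have hall : ∑ e, |completeVec v e| =
      ∑ e ∈ accept, |v e| + ∑ e ∈ acceptᶜ, |v e| + 2 * |(1 - ∑ i, v i) / 2| := by
    rw [Finset.sum_add_sum_compl]
    simp [completeVec]
  have hpos : 0 < ∑ e, |completeVec v e| := by
    have h1 : ∑ e, completeVec v e = 1 := by
      simp [completeVec]
      ring
    calc (0 : ℝ) < |∑ e, completeVec v e| := by rw [h1]; norm_num
      _ ≤ _ := Finset.abs_sum_le_sum_abs _ _
  rw [lt_div_iff₀ hpos, hacc, hall]
  constructor <;> intro h <;> linarith

end AfA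

/-! ### An affine automaton for the witness language -/

/-- The vector of the monomials `1, x, x², y, y², z`. -/
def countVec (x y z : ℝ) : Fin 6 → ℝ := ![1, x, x ^ 2, y, y ^ 2, z]

/-- Matrices that count letters in `countVec`, and at the right end-marker output
`x², y², y, z, x² - y - y² + z`. -/
def countTrans : TapeSymbol ABC → Matrix (Fin 6) (Fin 6) ℝ
  | .left => 1
  | .sym .a => !![1,0,0,0,0,0; 1,1,0,0,0,0; 1,2,1,0,0,0; 0,0,0,1,0,0; 0,0,0,0,1,0; 0,0,0,0,0,1]
  | .sym .b => !![1,0,0,0,0,0; 0,1,0,0,0,0; 0,0,1,0,0,0; 1,0,0,1,0,0; 1,0,0,2,1,0; 0,0,0,0,0,1]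
  | .sym .c => !![1,0,0,0,0,0; 0,1,0,0,0,0; 0,0,1,0,0,0; 0,0,0,1,0,0; 0,0,0,0,1,0; 1,0,0,0,0,1]
  | .right => !![0,0,1,0,0,0; 0,0,0,0,1,0; 0,0,0,1,0,0; 0,0,0,0,0,1; 0,0,1,-1,-1,1; 0,0,0,0,0,0]

theorem countTrans_a_mulVec (x y z : ℝ) :
    countTrans (.sym .a) *ᵥ countVec x y z = countVec (x + 1) y z := by
  ext i
  fin_cases i <;> simp [countTrans, countVec, mulVec, dotProduct, Fin.sum_univ_succ] <;> ring

theorem countTrans_b_mulVec (x y z : ℝ) :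
    countTrans (.sym .b) *ᵥ countVec x y z = countVec x (y + 1) z := by
  ext i
  fin_cases i <;> simp [countTrans, countVec, mulVec, dotProduct, Fin.sum_univ_succ] <;> ring

theorem countTrans_c_mulVec (x y z : ℝ) :
    countTrans (.sym .c) *ᵥ countVec x y z = countVec x y (z + 1) := by
  ext i
  fin_cases i <;> simp [countTrans, countVec, mulVec, dotProduct, Fin.sum_univ_succ]
  ring

theorem countTrans_right_mulVec (x y z : ℝ) :
    countTrans .right *ᵥ countVec x y z = ![x ^ 2, y ^ 2, y, z, x ^ 2 - y - y ^ 2 + z, 0] := by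
  ext i
  fin_cases i <;> simp [countTrans, countVec, mulVec, dotProduct, Fin.sum_univ_succ]
  ring

theorem foldl_countTrans (w : List ABC) (x y z : ℝ) :
    (w.map TapeSymbol.sym).foldl (fun v s => countTrans s *ᵥ v) (countVec x y z) =
      countVec (x + w.count .a) (y + w.count .b) (z + w.count .c) := by
  induction w generalizing x y z with
  | nil => simp
  | cons s w ih =>
    cases s <;>
      simp [countTrans_a_mulVec, countTrans_b_mulVec, countTrans_c_mulVec, ih,
        add_assoc, add_comm (1 : ℝ)]

theorem runMatrices_countTrans (w : List ABC) :
    runMatrices countTrans 0 (tape w) =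
      ![(w.count .a : ℝ) ^ 2, (w.count .b : ℝ) ^ 2, w.count .b, w.count .c,
        (w.count .a : ℝ) ^ 2 - w.count .b - (w.count .b : ℝ) ^ 2 + w.count .c, 0] := by
  have h0 : (Pi.single 0 1 : Fin 6 → ℝ) = countVec 0 0 0 := by
    ext i
    fin_cases i <;> simp [countVec]
  have hl : countTrans .left *ᵥ countVec 0 0 0 = countVec 0 0 0 := by simp [countTrans]
  rw [runMatrices, tape, h0, List.foldl_cons, hl, List.foldl_append, foldl_countTrans]
  simp [countTrans_right_mulVec]

/-- With `p = x² - y` and `q = y² - z` this is `0 < p ∧ 0 < q ↔ |p - q| < p + q`. -/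
theorem lt_pow_iff_abs_lt {x y z : ℝ} :
    (y < x ^ 2 ∧ z < y ^ 2) ↔ y + z + |x ^ 2 - y - y ^ 2 + z| < x ^ 2 + y ^ 2 := by
  rw [← lt_sub_iff_add_lt', abs_lt]
  constructor
  · rintro ⟨h1, h2⟩
    constructor <;> linarith
  · rintro ⟨h1, h2⟩
    constructor <;> linarith

theorem mem_lapinsWords_iff (w : List ABC) :
    w ∈ lapinsWords ↔ w.count .b < w.count .a ^ 2 ∧ w.count .c < w.count .b ^ 2 := by
  change (_ ∧ _) ↔ _
  rw [show w.count ABC.a ^ 4 = (w.count ABC.a ^ 2) ^ 2 by ring, gt_iff_lt, gt_iff_lt,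
    Nat.pow_lt_pow_iff_left two_ne_zero]

theorem complete_countTrans_recognizes :
    (AfA.complete countTrans 0 {0, 1}).RecognizesWithCutpoint (1 / 2) lapinsWords := by
  intro w
  have hc : ({0, 1} : Finset (Fin 6))ᶜ = {2, 3, 4, 5} := by decide
  rw [AfA.half_lt_complete_acceptValue_iff, runMatrices_countTrans, mem_lapinsWords_iff, hc]
  have h := @lt_pow_iff_abs_lt (w.count .a) (w.count .b) (w.count .c)
  have h1 : (w.count ABC.b < w.count ABC.a ^ 2 ∧ w.count ABC.c < w.count ABC.b ^ 2) ↔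
      ((w.count ABC.b : ℝ) < (w.count ABC.a : ℝ) ^ 2 ∧
        (w.count ABC.c : ℝ) < (w.count ABC.b : ℝ) ^ 2) := by
    norm_cast
  rw [h1, h]
  simp [add_assoc]

/-! ### Probabilistic automata: inclusion and linearization -/

namespace PFA

variable {α E : Type} [Fintype E] [DecidableEq E]

theorem final_nonneg_and_sum (P : PFA α E) (w : List α) :
    (∀ i, 0 ≤ P.final w i) ∧ ∑ i, P.final w i = 1 := by
  have key : ∀ (t : List (TapeSymbol α)) (v : E → ℝ), (∀ i, 0 ≤ v i) → ∑ i, v i = 1 →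
      (∀ i, 0 ≤ t.foldl (fun v s => P.trans s *ᵥ v) v i) ∧
        ∑ i, t.foldl (fun v s => P.trans s *ᵥ v) v i = 1 := by
    intro t
    induction t with
    | nil => exact fun v h0 h1 => ⟨h0, h1⟩
    | cons s t ih =>
      intro v h0 h1
      exact ih _ (nonneg_mulVec_of_mem_colStochastic (P.trans_stochastic s) h0)
        (by rw [sum_mulVec_of_mem_colStochastic (P.trans_stochastic s), h1])
  refine key _ _ (fun i => ?_) (by simp)
  by_cases h : i = P.start <;> simp [h]

/-- Every probabilistic automaton is affine. -/
def toAfA (P : PFA α E) : AfA α E where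
  trans := P.trans
  trans_sum s j := sum_col_of_mem_colStochastic (P.trans_stochastic s) j
  start := P.start
  accept := P.accept

theorem toAfA_acceptValue (P : PFA α E) (w : List α) : P.toAfA.acceptValue w = P.acceptProb w := by
  obtain ⟨h0, h1⟩ := P.final_nonneg_and_sum w
  change ∑ e ∈ P.accept, |P.final w e| / ∑ i, |P.final w i| = ∑ e ∈ P.accept, P.final w e
  simp only [abs_of_nonneg (h0 _), h1, div_one]

end PFA

theorem SL_subset_AfL : SL ⊆ AfL := by
  rintro L ⟨E, _, _, P, c, hc0, hc1, hP⟩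
  exact ⟨E, inferInstance, inferInstance, P.toAfA, c, hc0, hc1, fun w => by
    rw [P.toAfA_acceptValue, hP w]⟩

namespace PFA

variable {α E : Type} [Fintype E] [DecidableEq E]

/-- The accepting probability minus the cutpoint is linear in the product of the transition
matrices of the input letters. -/
theorem exists_linearMap_acceptProb_sub (P : PFA α E) (c : ℝ) :
    ∃ l : Matrix E E ℝ →ₗ[ℝ] ℝ, ∀ w : List α,
      P.acceptProb w - c = l ((w.reverse.map fun s => P.trans (.sym s)).prod) := by
  let v : E → ℝ := P.trans .left *ᵥ Pi.single P.start 1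
  -- The constant `c` becomes linear as `c` times the total mass, which is 1 on final states.
  let φ : (E → ℝ) →ₗ[ℝ] ℝ := ∑ e ∈ P.accept, LinearMap.proj e - c • ∑ e, LinearMap.proj e
  let l : Matrix E E ℝ →ₗ[ℝ] ℝ :=
    φ ∘ₗ (P.trans .right).mulVecLin ∘ₗ (Matrix.mulVecBilin ℝ ℝ).flip v
  refine ⟨l, fun w => ?_⟩
  have hfold : ∀ (w : List α) (u : E → ℝ),
      (w.map TapeSymbol.sym).foldl (fun v s => P.trans s *ᵥ v) u =
        (w.reverse.map fun s => P.trans (.sym s)).prod *ᵥ u := by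
    intro w
    induction w with
    | nil => intro u; simp
    | cons s w ih => intro u; simp [ih, mulVec_mulVec]
  have hfinal : P.final w =
      P.trans .right *ᵥ ((w.reverse.map fun s => P.trans (.sym s)).prod *ᵥ v) := by
    rw [final, runMatrices, tape, List.foldl_cons, List.foldl_append, hfold]
    rfl
  have hl : l ((w.reverse.map fun s => P.trans (.sym s)).prod) = φ (P.final w) := by
    rw [hfinal]
    rfl
  rw [hl]
  simp [φ, acceptProb, (P.final_nonneg_and_sum w).2]

end PFA

end

open Polynomial Filter Topology

/-! ### Multipliers with nonnegative coefficients -/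

/-- Some power of a complex number that is not a positive real has nonpositive real part. -/
theorem exists_pow_re_nonpos (u : ℂ) (hu : ¬ (0 < u.re ∧ u.im = 0)) : ∃ n : ℕ, (u ^ n).re ≤ 0 := by
  by_contra! h
  have hu0 : u ≠ 0 := by
    rintro rfl
    simpa using h 1
  have hre : 0 < u.re := by simpa using h 1
  have him : u.im ≠ 0 := fun h' => hu ⟨hre, h'⟩
  have hn : 0 < ‖u‖ := norm_pos_iff.2 hu0
  -- `s k` is the cosine of `2^k · arg u`, so `hs` below is the double-angle formula.
  let s : ℕ → ℝ := fun k => (u ^ 2 ^ k).re / ‖u‖ ^ 2 ^ k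
  have hs0 : ∀ k, 0 < s k := fun k => div_pos (h _) (by positivity)
  have hs : ∀ k, s (k + 1) = 2 * s k ^ 2 - 1 := by
    intro k
    have h1 : ‖u‖ ^ 2 ^ (k + 1) = (‖u‖ ^ 2 ^ k) ^ 2 := by rw [← pow_mul, pow_succ]
    have h2 : (u ^ 2 ^ (k + 1)).re = 2 * (u ^ 2 ^ k).re ^ 2 - (‖u‖ ^ 2 ^ k) ^ 2 := by
      rw [pow_succ, pow_mul, ← norm_pow, Complex.sq_norm, Complex.normSq_apply, sq (u ^ 2 ^ k),
        Complex.mul_re]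
      ring
    have h3 : ‖u‖ ^ 2 ^ k ≠ 0 := by positivity
    simp only [s, h1, h2]
    field_simp
  have hlt : 0 < 1 - s 0 := by
    have h1 : u.re < ‖u‖ := lt_of_le_of_ne (Complex.re_le_norm u) fun h' => him (by
      have h2 := Complex.sq_norm u
      rw [Complex.normSq_apply, ← h'] at h2
      have : u.im * u.im = 0 := by linarith [sq u.re]
      simpa using this)
    have h2 : s 0 < 1 := by
      simp only [s, pow_zero, pow_one]
      rwa [div_lt_one hn]
    linarith
  -- `1 - s (k+1) = 2 (1 - s k)(1 + s k)`, at least twice `1 - s k` while cosines stay positive;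
  -- unbounded growth then contradicts `0 < s k`.
  have hgrow : ∀ k, 2 ^ k * (1 - s 0) ≤ 1 - s k := by
    intro k
    induction k with
    | zero => simp
    | succ k ih =>
      have h1 : 0 ≤ 1 - s k := le_trans (by positivity) ih
      have h2 := mul_nonneg h1 (hs0 k).le
      rw [hs, pow_succ]
      nlinarith
  obtain ⟨k, hk⟩ := pow_unbounded_of_one_lt (1 / (1 - s 0)) (one_lt_two (α := ℝ))
  rw [div_lt_iff₀ hlt] at hk
  linarith [hgrow k, hs0 k]

/-- A complex number that is not a positive real is a root of a nonzero real polynomial with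
nonnegative coefficients. -/
theorem exists_nonneg_coeff_root (u : ℂ) (hu : ¬ (0 < u.re ∧ u.im = 0)) :
    ∃ q : ℝ[X], q ≠ 0 ∧ (∀ n, 0 ≤ q.coeff n) ∧ aeval u q = 0 := by
  obtain ⟨n, hn⟩ := exists_pow_re_nonpos u hu
  have hn0 : n ≠ 0 := by
    rintro rfl
    norm_num at hn
  -- This is `(X^n - u^n)(X^n - conj (u^n))`.
  refine ⟨X ^ (2 * n) + (C (-2 * (u ^ n).re) * X ^ n + C (Complex.normSq (u ^ n))), ?_, ?_, ?_⟩
  · intro h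
    have h1 : 2 * n ≠ n := by omega
    have := congrArg (coeff · (2 * n)) h
    simp only [coeff_add, coeff_C_mul, coeff_X_pow, coeff_C, h1, hn0, mul_eq_zero, OfNat.ofNat_ne_zero,
      or_self, if_true, if_false, coeff_zero] at this
    norm_num at this
  · intro m
    have h1 := Complex.normSq_nonneg (u ^ n)
    simp only [coeff_add, coeff_C_mul, coeff_X_pow, coeff_C]
    refine add_nonneg ?_ (add_nonneg (mul_nonneg (by linarith) ?_) ?_) <;> split_ifs <;>
      first | exact h1 | norm_num
  · set v := u ^ n with hv
    simp only [map_add, map_mul, map_pow, aeval_X, aeval_C, pow_mul', ← hv]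
    apply Complex.ext <;> simp [Complex.normSq_apply, sq] <;> ring

theorem coeff_mul_nonneg {p q : ℝ[X]} (hp : ∀ n, 0 ≤ p.coeff n) (hq : ∀ n, 0 ≤ q.coeff n) (n : ℕ) :
    0 ≤ (p * q).coeff n := by
  rw [coeff_mul]
  exact Finset.sum_nonneg fun _ _ => mul_nonneg (hp _) (hq _)

/-- Every nonzero real polynomial divides the product of a polynomial with nonnegative coefficients
and powers of linear factors with positive roots. -/
theorem exists_nonneg_coeff_dvd (p : ℝ[X]) (hp : p ≠ 0) :
    ∃ (q : ℝ[X]) (S : Finset ℝ) (m : ℕ), q ≠ 0 ∧ (∀ n, 0 ≤ q.coeff n) ∧ (∀ a ∈ S, 0 < a) ∧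
      p ∣ q * ∏ a ∈ S, (X - C a) ^ m := by
  classical
  have key : ∀ s : Multiset ℂ, ∃ (q : ℝ[X]) (T : Multiset ℝ), q ≠ 0 ∧ (∀ n, 0 ≤ q.coeff n) ∧
      (∀ a ∈ T, 0 < a) ∧ (s.map fun u => X - C u).prod ∣
        (q * (T.map fun a => X - C a).prod).map (algebraMap ℝ ℂ) := by
    intro s
    induction s using Multiset.induction with
    | empty => exact ⟨1, 0, one_ne_zero, fun n => by rw [coeff_one]; split_ifs <;> simp, by simp,
        by simp⟩
    | cons u s ih =>
      obtain ⟨q, T, hq0, hq, hT, hdvd⟩ := ih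
      by_cases hu : 0 < u.re ∧ u.im = 0
      · refine ⟨q, u.re ::ₘ T, hq0, hq, ?_, ?_⟩
        · intro a ha
          rcases Multiset.mem_cons.1 ha with rfl | ha
          exacts [hu.1, hT a ha]
        · have hu' : ((u.re : ℝ) : ℂ) = u := Complex.ext (by simp) (by simp [hu.2])
          simp only [Multiset.map_cons, Multiset.prod_cons]
          rw [mul_left_comm, Polynomial.map_mul]
          refine mul_dvd_mul ?_ hdvd
          simp [hu']
      · obtain ⟨r, hr0, hr, hru⟩ := exists_nonneg_coeff_root u hu
        refine ⟨r * q, T, mul_ne_zero hr0 hq0, coeff_mul_nonneg hr hq, hT, ?_⟩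
        simp only [Multiset.map_cons, Multiset.prod_cons]
        rw [mul_assoc, Polynomial.map_mul]
        refine mul_dvd_mul ?_ hdvd
        rw [dvd_iff_isRoot, IsRoot, eval_map_algebraMap, hru]
  obtain ⟨q, T, hq0, hq, hT, hdvd⟩ := key (p.map (algebraMap ℝ ℂ)).roots
  -- `T.card` bounds every multiplicity, so a single exponent serves all roots.
  refine ⟨q, T.toFinset, T.card, hq0, hq, fun a ha => hT a (Multiset.mem_toFinset.1 ha), ?_⟩
  have hsplit := (IsAlgClosed.splits (p.map (algebraMap ℝ ℂ))).eq_prod_roots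
  have hp1 : p ∣ q * (T.map fun a => X - C a).prod := by
    have hlead : IsUnit (C (p.map (algebraMap ℝ ℂ)).leadingCoeff) :=
      isUnit_C.2 (isUnit_iff_ne_zero.2 (by simpa using hp))
    rw [← map_dvd_map' (algebraMap ℝ ℂ), hsplit]
    exact hlead.mul_left_dvd.2 hdvd
  refine hp1.trans (mul_dvd_mul_left q ?_)
  rw [Finset.prod_multiset_map_count]
  exact Finset.prod_dvd_prod_of_dvd _ _ fun a _ => pow_dvd_pow _ (Multiset.count_le_card a T)

/-! ### Averaged powers as exponential polynomials -/

/-- Chinese remainder decomposition of the unit with respect to powers of linear factors. -/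
theorem exists_sum_dvd_sub_one (S : Finset ℝ) (m : ℕ) :
    ∃ e : ℝ → ℝ[X], (∀ a ∈ S, ∏ b ∈ S, (X - C b) ^ m ∣ (X - C a) ^ m * e a) ∧
      ∏ b ∈ S, (X - C b) ^ m ∣ ∑ a ∈ S, e a - 1 := by
  classical
  rcases S.eq_empty_or_nonempty with rfl | hS
  · exact ⟨0, by simp, by simp⟩
  have hpair : Pairwise fun a b : S => IsCoprime ((X - C (a : ℝ)) ^ m) ((X - C (b : ℝ)) ^ m) :=
    fun a b hab => (isCoprime_X_sub_C_of_isUnit_sub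
      (sub_ne_zero.2 (Subtype.coe_injective.ne hab)).isUnit).pow
  obtain ⟨μ, hμ⟩ := (exists_sum_eq_one_iff_pairwise_coprime
    (s := fun a : ℝ => (X - C a) ^ m) hS).2 hpair
  refine ⟨fun a => μ a * ∏ b ∈ S \ {a}, (X - C b) ^ m, fun a ha => ⟨μ a, ?_⟩, by simp [hμ]⟩
  rw [← Finset.prod_sdiff (Finset.singleton_subset_iff.2 ha), Finset.prod_singleton]
  ring

/-- Powers of an algebraic element, averaged with suitable nonnegative weights, are exponential
polynomials with positive bases. -/
theorem exists_pow_mul_aeval_eq {R : Type*} [Ring R] [Algebra ℝ R] (r : R) (hr : IsIntegral ℝ r) :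
    ∃ (q : ℝ[X]) (I : Finset (ℝ × ℕ)) (M : ℝ × ℕ → R), q ≠ 0 ∧ (∀ n, 0 ≤ q.coeff n) ∧
      (∀ p ∈ I, 0 < p.1) ∧
      ∀ x : ℕ, r ^ x * aeval r q = ∑ p ∈ I, (p.1 ^ x * (x.choose p.2 : ℝ)) • M p := by
  obtain ⟨q, S, m, hq0, hq, hS, hdvd⟩ := exists_nonneg_coeff_dvd (minpoly ℝ r) (minpoly.ne_zero hr)
  obtain ⟨e, he, he1⟩ := exists_sum_dvd_sub_one S m
  -- After multiplication by `q`, evaluation at `r` depends only on the class modulo the product of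
  -- linear factors; there `1 = ∑ e a`, and on `e a` the element `X - C a` is nilpotent.
  have hzero : ∀ f : ℝ[X], ∏ b ∈ S, (X - C b) ^ m ∣ f → aeval r (q * f) = 0 := by
    intro f hf
    obtain ⟨g, hg⟩ := hdvd.trans (mul_dvd_mul_left q hf)
    rw [hg, map_mul, minpoly.aeval, zero_mul]
  refine ⟨q, S ×ˢ Finset.range m,
    fun p => (p.1 ^ p.2)⁻¹ • aeval r (q * ((X - C p.1) ^ p.2 * e p.1)), hq0, hq,
    fun p hp => hS _ (Finset.mem_product.1 hp).1, fun x => ?_⟩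
  have h1 : r ^ x * aeval r q = ∑ a ∈ S, aeval r (q * (X ^ x * e a)) := by
    have h := hzero (X ^ x * (∑ a ∈ S, e a - 1)) (he1.mul_left _)
    rw [mul_sub, mul_sub, map_sub, sub_eq_zero, mul_one, Finset.mul_sum, Finset.mul_sum,
      map_sum] at h
    rw [h, mul_comm q, map_mul, map_pow, aeval_X]
  rw [h1, Finset.sum_product]
  refine Finset.sum_congr rfl fun a ha => ?_
  have ha0 : a ≠ 0 := (hS a ha).ne'
  -- Terms of the binomial expansion of `((X - a) + a)^x`. For `k > x` the truncated `x - k` is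
  -- harmless since the binomial coefficient vanishes.
  have hterm : ∀ k, aeval r (q * ((X - C a) ^ k * C a ^ (x - k) * (x.choose k : ℝ[X]) * e a)) =
      (a ^ x * (x.choose k : ℝ)) • (a ^ k)⁻¹ • aeval r (q * ((X - C a) ^ k * e a)) := by
    intro k
    rcases le_or_gt k x with hk | hk
    · have h2 : a ^ x * (x.choose k : ℝ) * (a ^ k)⁻¹ = a ^ (x - k) * (x.choose k : ℝ) := by
        rw [pow_sub₀ _ ha0 hk]
        ring
      rw [smul_smul, h2, ← map_smul, smul_eq_C_mul]
      congr 1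
      simp only [map_mul, map_pow, map_natCast]
      ring
    · simp [Nat.choose_eq_zero_of_lt hk]
  have hbig : ∀ k, m ≤ k →
      aeval r (q * ((X - C a) ^ k * C a ^ (x - k) * (x.choose k : ℝ[X]) * e a)) = 0 := by
    intro k hk
    apply hzero
    obtain ⟨j, rfl⟩ := Nat.exists_eq_add_of_le hk
    refine (he a ha).trans ⟨(X - C a) ^ j * C a ^ (x - (m + j)) * (x.choose (m + j) : ℝ[X]), ?_⟩
    ring
  have h3 : (X : ℝ[X]) ^ x = ∑ k ∈ Finset.range (x + 1),
      (X - C a) ^ k * C a ^ (x - k) * (x.choose k : ℝ[X]) := by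
    rw [← add_pow, sub_add_cancel]
  have h4 : ∀ N, x < N → aeval r (q * (X ^ x * e a)) = ∑ k ∈ Finset.range N,
      aeval r (q * ((X - C a) ^ k * C a ^ (x - k) * (x.choose k : ℝ[X]) * e a)) := by
    intro N hN
    rw [h3, Finset.sum_mul, Finset.mul_sum, map_sum]
    refine Finset.sum_subset (Finset.range_mono hN) fun k _ hk => ?_
    have : x < k := by simpa using hk
    simp [Nat.choose_eq_zero_of_lt this]
  rw [h4 (max (x + 1) m) (by omega), ← Finset.sum_subset (Finset.range_mono (le_max_right (x + 1) m))
    fun k _ hk => hbig k (by simpa using hk)]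
  exact Finset.sum_congr rfl fun k _ => hterm k

/-! ### The impossible sign pattern -/

/-- A nonzero bivariate polynomial cannot be nonnegative for `y < 1`, `z < y²` and nonpositive for
`y > 1` or `z > y²`. -/
theorem not_sign_quadrants (h : ℝ[X][X]) (h0 : h ≠ 0)
    (hpos : ∀ y z : ℚ, 0 < y → 0 < z → y < 1 → z < y ^ 2 → 0 ≤ evalEval (z : ℝ) (y : ℝ) h)
    (hneg : ∀ y z : ℚ, 0 < y → 0 < z → (1 < y ∨ y ^ 2 < z) → evalEval (z : ℝ) (y : ℝ) h ≤ 0) :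
    False := by
  -- The outer variable is `y`: the full power of `y - 1` is split off, so `q` at `y = 1` is a
  -- nonzero polynomial in `z`.
  obtain ⟨q, hq, hndvd⟩ := exists_eq_pow_rootMultiplicity_mul_and_not_dvd h h0 1
  set n := rootMultiplicity 1 h
  have hL : eval 1 q ≠ 0 := fun h' => hndvd (dvd_iff_isRoot.2 h')
  have heval : ∀ y z : ℝ, evalEval z y h = (y - 1) ^ n * evalEval z y q := by
    intro y z
    conv_lhs => rw [hq]
    simp [evalEval]
  have hcont : ∀ z : ℝ, Continuous fun y : ℝ => evalEval z y q := by
    intro z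
    have : (fun y : ℝ => evalEval z y q) = fun y => eval y (q.map (evalRingHom z)) := by
      ext y
      exact (map_evalRingHom_eval ..).symm
    rw [this]
    exact Polynomial.continuous _
  have hone : ∀ z : ℝ, evalEval z 1 q = eval z (eval 1 q) := fun z => by simp [evalEval]
  have hseq : Tendsto (fun m : ℕ => (1 : ℝ) / ((m : ℝ) + 1)) atTop (𝓝 0) :=
    tendsto_one_div_add_atTop_nhds_zero_nat
  have hp : ∀ z : ℝ, Tendsto (fun m : ℕ => evalEval z (1 + 1 / ((m : ℝ) + 1)) q) atTop
      (𝓝 (eval z (eval 1 q))) := by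
    intro z
    have h1 := ((hcont z).tendsto (1 + 0)).comp (hseq.const_add (1 : ℝ))
    rwa [add_zero, hone] at h1
  have hm : ∀ z : ℝ, Tendsto (fun m : ℕ => evalEval z (1 - 1 / ((m : ℝ) + 1)) q) atTop
      (𝓝 (eval z (eval 1 q))) := by
    intro z
    have h1 := ((hcont z).tendsto (1 - 0)).comp (hseq.const_sub (1 : ℝ))
    rwa [sub_zero, hone] at h1
  have hright : ∀ z : ℚ, 0 < z → eval (z : ℝ) (eval 1 q) ≤ 0 := by
    intro z hz
    refine le_of_tendsto' (hp z) fun m => ?_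
    have h1 := hneg (1 + 1 / ((m : ℚ) + 1)) z (by positivity) hz
      (Or.inl (lt_add_of_pos_right _ (by positivity)))
    push_cast at h1
    rw [heval, add_sub_cancel_left] at h1
    exact nonpos_of_mul_nonpos_right h1 (by positivity)
  have hroot : ∀ f : ℕ → ℝ, Function.Injective f → ∃ p, eval (f p) (eval 1 q) ≠ 0 := by
    intro f hf
    by_contra! hall
    exact hL (eq_zero_of_infinite_isRoot _
      ((Set.infinite_range_of_injective hf).mono (by rintro _ ⟨p, rfl⟩; exact hall p)))
  have hleft : ∀ z : ℚ, ∀ m : ℕ, evalEval (z : ℝ) (1 - 1 / ((m : ℝ) + 1)) h =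
      (-1) ^ n * ((1 / ((m : ℝ) + 1)) ^ n * evalEval (z : ℝ) (1 - 1 / ((m : ℝ) + 1)) q) := by
    intro z m
    rw [heval, ← mul_assoc, ← mul_pow]
    congr 2
    ring
  -- For `n` even, the required sign change across `y = 1` at `z < 1` forces `q(1, z) = 0`; for `n`
  -- odd, the absence of one at `z > 1` does. Either way there are infinitely many roots.
  rcases Nat.even_or_odd n with hn | hn
  · obtain ⟨p, hp0⟩ := hroot (fun p => ((1 / ((p : ℚ) + 2) : ℚ) : ℝ)) (by
      intro a b hab
      simpa using hab)
    set z : ℚ := 1 / ((p : ℚ) + 2) with hz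
    have hz0 : 0 < z := by positivity
    have hz1 : z ≤ 1 / 2 := one_div_le_one_div_of_le (by norm_num) (by linarith [p.cast_nonneg (α := ℚ)])
    refine hp0 (le_antisymm (hright z hz0) (ge_of_tendsto (hm z) ?_))
    filter_upwards [eventually_ge_atTop 4] with m hm4
    have hm4' : (4 : ℚ) ≤ m := by exact_mod_cast hm4
    have hi : (1 : ℚ) / ((m : ℚ) + 1) ≤ 1 / 5 :=
      one_div_le_one_div_of_le (by norm_num) (by linarith)
    have hi0 : (0 : ℚ) < 1 / ((m : ℚ) + 1) := by positivity
    have h1 := hpos (1 - 1 / ((m : ℚ) + 1)) z (by linarith) hz0 (by linarith) (by nlinarith)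
    push_cast at h1
    rw [hleft, hn.neg_one_pow, one_mul] at h1
    exact nonneg_of_mul_nonneg_right h1 (by positivity)
  · obtain ⟨p, hp0⟩ := hroot (fun p => ((p : ℚ) + 2 : ℚ)) (by
      intro a b hab
      simpa using hab)
    set z : ℚ := (p : ℚ) + 2 with hz
    have hz0 : 0 < z := by positivity
    have hz1 : 2 ≤ z := by linarith [p.cast_nonneg (α := ℚ)]
    refine hp0 (le_antisymm (hright z hz0) (ge_of_tendsto (hm z) ?_))
    filter_upwards [eventually_ge_atTop 1] with m hm1
    have hm1' : (1 : ℚ) ≤ m := by exact_mod_cast hm1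
    have hi : (1 : ℚ) / ((m : ℚ) + 1) ≤ 1 / 2 :=
      one_div_le_one_div_of_le (by norm_num) (by linarith)
    have hi0 : (0 : ℚ) < 1 / ((m : ℚ) + 1) := by positivity
    have h1 := hneg (1 - 1 / ((m : ℚ) + 1)) z (by linarith) hz0 (Or.inr (by nlinarith))
    push_cast at h1
    rw [hleft, hn.neg_one_pow, neg_one_mul, neg_nonpos] at h1
    exact nonneg_of_mul_nonneg_right h1 (by positivity)

/-! ### Asymptotics along the scaling `(t, t², t⁴)` -/

theorem tendsto_choose_div_pow (e ξ i : ℕ) (he : e ≠ 0) (hξ : 0 < ξ) :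
    Tendsto (fun t : ℕ => ((t ^ e * ξ).choose i : ℝ) / (t : ℝ) ^ (e * i)) atTop
      (𝓝 ((ξ : ℝ) ^ i / i.factorial)) := by
  have harg : Tendsto (fun t : ℕ => t ^ e * ξ) atTop atTop :=
    (tendsto_pow_atTop he).atTop_mul_const' hξ
  have h1 := (Asymptotics.isEquivalent_iff_tendsto_one (by
    filter_upwards [eventually_gt_atTop 0] with n hn
    simp only [Function.comp_apply]
    positivity)).1 ((isEquivalent_choose i).comp_tendsto harg)
  have h2 := h1.mul_const ((ξ : ℝ) ^ i / i.factorial)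
  rw [one_mul] at h2
  refine h2.congr' ?_
  filter_upwards [eventually_gt_atTop 0] with t ht
  have : (t : ℝ) ≠ 0 := by positivity
  have : (ξ : ℝ) ≠ 0 := by positivity
  simp only [Pi.div_apply, Function.comp_apply]
  push_cast
  rw [mul_pow, ← pow_mul]
  field_simp

/-- Lexicographically negative combinations of `t⁴, t², t, log t` tend to `-∞`. -/
theorem tendsto_lex_atBot (A B C E : ℝ)
    (h : A < 0 ∨ A = 0 ∧ (B < 0 ∨ B = 0 ∧ (C < 0 ∨ C = 0 ∧ E < 0))) :
    Tendsto (fun t : ℝ => A * t ^ 4 + B * t ^ 2 + C * t + E * Real.log t) atTop atBot := by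
  have hlog : ∀ t : ℝ, 1 ≤ t → E * Real.log t ≤ |E| * t := fun t ht =>
    (mul_le_mul_of_nonneg_right (le_abs_self E) (Real.log_nonneg ht)).trans
      (mul_le_mul_of_nonneg_left (Real.log_le_self (by linarith)) (abs_nonneg E))
  rcases h with hA | ⟨rfl, hB | ⟨rfl, hC | ⟨rfl, hE⟩⟩⟩
  · have h1 : Tendsto (fun t : ℝ => t ^ 2 * (A * t ^ 2 + (|B| + |C| + |E|))) atTop atBot := by
      refine Tendsto.atTop_mul_atBot₀ (tendsto_pow_atTop two_ne_zero) ?_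
      exact tendsto_atBot_add_const_right _ _
        ((tendsto_pow_atTop two_ne_zero).const_mul_atTop_of_neg hA)
    refine tendsto_atBot_mono' _ ?_ h1
    filter_upwards [eventually_ge_atTop 1] with t ht
    have h2 : B * t ^ 2 ≤ |B| * t ^ 2 := mul_le_mul_of_nonneg_right (le_abs_self B) (by positivity)
    have h3 : C * t ≤ |C| * t := mul_le_mul_of_nonneg_right (le_abs_self C) (by positivity)
    have h4 : t ≤ t ^ 2 := le_self_pow₀ ht two_ne_zero
    have h5 := mul_le_mul_of_nonneg_left h4 (abs_nonneg C)
    have h6 := mul_le_mul_of_nonneg_left h4 (abs_nonneg E)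
    have h7 := hlog t ht
    linarith
  · have h1 : Tendsto (fun t : ℝ => t * (B * t + (|C| + |E|))) atTop atBot := by
      refine Tendsto.atTop_mul_atBot₀ tendsto_id ?_
      exact tendsto_atBot_add_const_right _ _ (tendsto_id.const_mul_atTop_of_neg hB)
    refine tendsto_atBot_mono' _ ?_ h1
    filter_upwards [eventually_ge_atTop 1] with t ht
    have h3 : C * t ≤ |C| * t := mul_le_mul_of_nonneg_right (le_abs_self C) (by positivity)
    have h7 := hlog t ht
    linarith
  · have h1 : Tendsto (fun t : ℝ => t * (C + E * (Real.log t / t))) atTop atBot := by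
      refine Tendsto.atTop_mul_neg hC tendsto_id ?_
      have h2 := ((Real.isLittleO_log_id_atTop.tendsto_div_nhds_zero).const_mul E).const_add C
      simpa using h2
    refine h1.congr' ?_
    filter_upwards [eventually_ge_atTop 1] with t ht
    field_simp
    ring
  · simpa using Real.tendsto_log_atTop.const_mul_atTop_of_neg hE

/-- The logarithm is `ζ log c · t⁴ + η log b · t² + ξ log a · t + (n - d) log t`, to which
`tendsto_lex_atBot` applies. -/
theorem tendsto_scale_zero (a b c : ℝ) (ha : 0 < a) (hb : 0 < b) (hc : 0 < c) (ξ η ζ n d : ℕ)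
    (hξ : 0 < ξ) (hη : 0 < η) (hζ : 0 < ζ)
    (h : c < 1 ∨ c = 1 ∧ (b < 1 ∨ b = 1 ∧ (a < 1 ∨ a = 1 ∧ n < d))) :
    Tendsto (fun t : ℕ => a ^ (t * ξ) * b ^ (t ^ 2 * η) * c ^ (t ^ 4 * ζ) *
      ((t : ℝ) ^ n / (t : ℝ) ^ d)) atTop (𝓝 0) := by
  have h1 := (Real.tendsto_exp_atBot.comp (tendsto_lex_atBot (ζ * Real.log c) (η * Real.log b)
    (ξ * Real.log a) (n - d) ?_)).comp (tendsto_natCast_atTop_atTop (R := ℝ))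
  · refine h1.congr' ?_
    filter_upwards [eventually_gt_atTop 0] with t ht
    have ht' : (0 : ℝ) < t := by exact_mod_cast ht
    have he : ∀ (x : ℝ) (k : ℕ), 0 < x → x ^ k = Real.exp (k * Real.log x) := by
      intro x k hx
      rw [Real.exp_nat_mul, Real.exp_log hx]
    simp only [Function.comp_apply]
    rw [he a _ ha, he b _ hb, he c _ hc, he _ n ht', he _ d ht', ← Real.exp_sub, ← Real.exp_add,
      ← Real.exp_add, ← Real.exp_add]
    congr 1
    push_cast
    ring
  · have hξ' : (0 : ℝ) < ξ := by exact_mod_cast hξ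
    have hη' : (0 : ℝ) < η := by exact_mod_cast hη
    have hζ' : (0 : ℝ) < ζ := by exact_mod_cast hζ
    rcases h with h | ⟨rfl, h | ⟨rfl, h | ⟨rfl, h⟩⟩⟩
    · exact Or.inl (mul_neg_of_pos_of_neg hζ' (Real.log_neg hc h))
    · exact Or.inr ⟨by simp, Or.inl (mul_neg_of_pos_of_neg hη' (Real.log_neg hb h))⟩
    · exact Or.inr ⟨by simp, Or.inr ⟨by simp,
        Or.inl (mul_neg_of_pos_of_neg hξ' (Real.log_neg ha h))⟩⟩
    · refine Or.inr ⟨by simp, Or.inr ⟨by simp, Or.inr ⟨by simp, ?_⟩⟩⟩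
      rw [sub_neg]
      exact_mod_cast h

/-- The index of an exponential monomial in three variables: bases and degrees. -/
abbrev ExpIndex : Type := (ℝ × ℕ) × (ℝ × ℕ) × (ℝ × ℕ)

namespace ExpIndex

/-- The exponential monomial with bases and degrees `j`. -/
noncomputable def term (j : ExpIndex) (x y z : ℕ) : ℝ :=
  (j.1.1 ^ x * (x.choose j.1.2 : ℝ)) * (j.2.1.1 ^ y * (y.choose j.2.1.2 : ℝ)) *
    (j.2.2.1 ^ z * (z.choose j.2.2.2 : ℝ))

/-- The weighted degree for the scaling `(t, t², t⁴)`. -/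
def deg (j : ExpIndex) : ℕ := j.1.2 + 2 * j.2.1.2 + 4 * j.2.2.2

/-- The order of growth of a term under the scaling `(t, t², t⁴)`. -/
def growth (j : ExpIndex) : ℝ ×ₗ ℝ ×ₗ ℝ ×ₗ ℕ :=
  toLex (j.2.2.1, toLex (j.2.1.1, toLex (j.1.1, j.deg)))

/-- The order of growth of the term `j` at `(t ξ, t² η, t⁴ ζ)`. -/
noncomputable def scale (j : ExpIndex) (ξ η ζ t : ℕ) : ℝ :=
  j.1.1 ^ (t * ξ) * j.2.1.1 ^ (t ^ 2 * η) * j.2.2.1 ^ (t ^ 4 * ζ) * (t : ℝ) ^ j.deg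

/-- All three bases are positive. -/
def Pos (j : ExpIndex) : Prop := 0 < j.1.1 ∧ 0 < j.2.1.1 ∧ 0 < j.2.2.1

theorem tendsto_scale_div_scale {j k : ExpIndex} (hj : j.Pos) (hk : k.Pos)
    (h : j.growth < k.growth) {ξ η ζ : ℕ} (hξ : 0 < ξ) (hη : 0 < η) (hζ : 0 < ζ) :
    Tendsto (fun t => j.scale ξ η ζ t / k.scale ξ η ζ t) atTop (𝓝 0) := by
  obtain ⟨hj1, hj2, hj3⟩ := hj
  obtain ⟨hk1, hk2, hk3⟩ := hk
  refine (tendsto_scale_zero (j.1.1 / k.1.1) (j.2.1.1 / k.2.1.1) (j.2.2.1 / k.2.2.1)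
    (by positivity) (by positivity) (by positivity) ξ η ζ j.deg k.deg hξ hη hζ ?_).congr ?_
  · simp only [growth, Prod.Lex.toLex_lt_toLex] at h
    simpa only [div_lt_one hk1, div_lt_one hk2, div_lt_one hk3, div_eq_one_iff_eq hk1.ne',
      div_eq_one_iff_eq hk2.ne', div_eq_one_iff_eq hk3.ne'] using h
  · intro t
    simp only [scale, div_pow]
    ring

theorem tendsto_term_div_scale {j : ExpIndex} (hj : j.Pos) {ξ η ζ : ℕ} (hξ : 0 < ξ) (hη : 0 < η)
    (hζ : 0 < ζ) :
    Tendsto (fun t => j.term (t * ξ) (t ^ 2 * η) (t ^ 4 * ζ) / j.scale ξ η ζ t) atTop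
      (𝓝 ((ξ : ℝ) ^ j.1.2 / j.1.2.factorial * ((η : ℝ) ^ j.2.1.2 / j.2.1.2.factorial) *
        ((ζ : ℝ) ^ j.2.2.2 / j.2.2.2.factorial))) := by
  obtain ⟨hj1, hj2, hj3⟩ := hj
  refine (((tendsto_choose_div_pow 1 ξ j.1.2 one_ne_zero hξ).mul
    (tendsto_choose_div_pow 2 η j.2.1.2 two_ne_zero hη)).mul
      (tendsto_choose_div_pow 4 ζ j.2.2.2 four_ne_zero hζ)).congr' ?_
  filter_upwards [eventually_gt_atTop 0] with t ht
  have : (t : ℝ) ≠ 0 := by positivity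
  simp only [term, scale, deg, pow_add, pow_one, one_mul]
  field_simp

end ExpIndex

open ExpIndex in
/-- Leading part of an exponential polynomial under the scaling `(t, t², t⁴)`. -/
theorem exists_leading_polynomial (I : Finset ExpIndex) (c : ExpIndex → ℝ) (hI : ∀ j ∈ I, j.Pos)
    (hc : ∃ j ∈ I, c j ≠ 0) :
    ∃ h : ℝ[X][X], h ≠ 0 ∧ ∃ s : ℕ → ℕ → ℕ → ℕ → ℝ, (∀ ξ η ζ t, 0 ≤ s ξ η ζ t) ∧
      ∀ ξ η ζ : ℕ, 0 < ξ → 0 < η → 0 < ζ →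
        Tendsto (fun t => (∑ j ∈ I, c j * j.term (t * ξ) (t ^ 2 * η) (t ^ 4 * ζ)) / s ξ η ζ t) atTop
          (𝓝 (evalEval ((ζ : ℝ) / ξ ^ 4) ((η : ℝ) / ξ ^ 2) h)) := by
  classical
  obtain ⟨k, hk, hmax⟩ := (I.filter fun j => c j ≠ 0).exists_max_image growth
    (by obtain ⟨j, hj, hj0⟩ := hc; exact ⟨j, Finset.mem_filter.2 ⟨hj, hj0⟩⟩)
  obtain ⟨hkI, hk0⟩ := Finset.mem_filter.1 hk
  -- Only terms of maximal growth survive; the factorials come from `choose n i ~ n^i / i!`.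
  let w : ExpIndex → ℝ := fun j => if j.growth = k.growth then
    c j / (j.1.2.factorial * j.2.1.2.factorial * j.2.2.2.factorial) else 0
  let h : ℝ[X][X] := ∑ j ∈ I, monomial j.2.1.2 (monomial j.2.2.2 (w j))
  have hgrowth : ∀ j : ExpIndex, j.growth = k.growth →
      j.2.2.1 = k.2.2.1 ∧ j.2.1.1 = k.2.1.1 ∧ j.1.1 = k.1.1 ∧ j.deg = k.deg := by
    intro j hj
    simpa [growth] using hj
  -- The factor `ξ ^ k.deg` dehomogenizes: surviving terms share the weighted degree, so only `η/ξ²`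
  -- and `ζ/ξ⁴` remain.
  refine ⟨h, ?_, fun ξ η ζ t => k.scale ξ η ζ t * ξ ^ k.deg, ?_, ?_⟩
  · intro h0
    have h1 : (h.coeff k.2.1.2).coeff k.2.2.2 = w k := by
      simp only [h, finsetSum_coeff, coeff_monomial]
      rw [Finset.sum_eq_single k]
      · simp
      · intro j _ hjk
        split_ifs with h2
        · rw [coeff_monomial]
          split_ifs with h3
          · by_cases h4 : j.growth = k.growth
            · obtain ⟨e1, e2, e3, e4⟩ := hgrowth j h4
              refine absurd ?_ hjk
              -- The weighted degree and the degrees in `y`, `z` determine the degree in `x`, so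
              -- distinct leading terms give distinct monomials and cannot cancel.
              have e5 : j.1.2 = k.1.2 := by
                simp only [deg] at e4
                omega
              exact Prod.ext (Prod.ext e3 e5) (Prod.ext (Prod.ext e2 h2) (Prod.ext e1 h3))
            · simp [w, h4]
          · rfl
        · simp
      · exact fun h' => absurd hkI h'
    have h2 : w k ≠ 0 := by
      simp only [w, if_true]
      exact div_ne_zero hk0 (by positivity)
    rw [h0] at h1
    exact h2 (by simpa using h1.symm)
  · intro ξ η ζ t
    obtain ⟨h1, h2, h3⟩ := hI k hkI
    simp only [scale]
    positivity
  · intro ξ η ζ hξ hη hζ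
    have hξ' : (ξ : ℝ) ≠ 0 := by positivity
    have hh : evalEval ((ζ : ℝ) / ξ ^ 4) ((η : ℝ) / ξ ^ 2) h =
        ∑ j ∈ I, w j * ((ζ : ℝ) / ξ ^ 4) ^ j.2.2.2 * ((η : ℝ) / ξ ^ 2) ^ j.2.1.2 := by
      simp [h, evalEval, eval_finsetSum, eval_monomial]
    simp only [hh, Finset.sum_div]
    refine tendsto_finsetSum _ fun j hj => ?_
    by_cases hcj : c j = 0
    · simp [w, hcj]
    have hlim := tendsto_term_div_scale (hI j hj) hξ hη hζ
    by_cases hjk : j.growth = k.growth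
    · obtain ⟨e1, e2, e3, e4⟩ := hgrowth j hjk
      have hs : ∀ t, j.scale ξ η ζ t = k.scale ξ η ζ t := fun t => by simp only [scale, e1, e2, e3, e4]
      have h1 := hlim.const_mul (c j / ξ ^ k.deg)
      have h2 : c j / (ξ : ℝ) ^ k.deg * ((ξ : ℝ) ^ j.1.2 / j.1.2.factorial *
          ((η : ℝ) ^ j.2.1.2 / j.2.1.2.factorial) * ((ζ : ℝ) ^ j.2.2.2 / j.2.2.2.factorial)) =
          w j * ((ζ : ℝ) / ξ ^ 4) ^ j.2.2.2 * ((η : ℝ) / ξ ^ 2) ^ j.2.1.2 := by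
        rw [← e4]
        simp only [w, hjk, if_true, deg, div_pow, pow_add, pow_mul]
        field_simp
      rw [h2] at h1
      refine h1.congr fun t => ?_
      rw [hs]
      ring
    · have hlt : j.growth < k.growth :=
        lt_of_le_of_ne (hmax j (Finset.mem_filter.2 ⟨hj, hcj⟩)) hjk
      have h1 := (hlim.mul (tendsto_scale_div_scale (hI j hj) (hI k hkI) hlt hξ hη hζ)).const_mul
        (c j / ξ ^ k.deg)
      simp only [mul_zero] at h1
      have h2 : w j = 0 := by simp [w, hjk]
      rw [h2, zero_mul, zero_mul]
      refine h1.congr' ?_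
      filter_upwards [eventually_gt_atTop 0] with t ht
      have h3 : j.scale ξ η ζ t ≠ 0 := by
        obtain ⟨h1, h2, h3⟩ := hI j hj
        simp only [scale]
        positivity
      field_simp

/-! ### Exclusion of the region, and conclusion -/

theorem eventually_box_inside {ξ η ζ : ℕ} (h1 : η < ξ ^ 2) (h2 : ζ < η ^ 2) (d : ℕ) :
    ∀ᶠ t : ℕ in atTop, ∀ i j k : ℕ, i ≤ d → j ≤ d → k ≤ d →
      t ^ 2 * η + j < (t * ξ + i) ^ 2 ∧ t ^ 4 * ζ + k < (t ^ 2 * η + j) ^ 2 := by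
  filter_upwards [eventually_gt_atTop d] with t ht i j k hi hj hk
  have ht2 : t ≤ t ^ 2 := Nat.le_self_pow two_ne_zero t
  have ht4 : t ≤ t ^ 4 := Nat.le_self_pow four_ne_zero t
  have h1' : t ^ 2 * (η + 1) ≤ t ^ 2 * ξ ^ 2 := Nat.mul_le_mul_left _ h1
  have h2' : t ^ 4 * (ζ + 1) ≤ t ^ 4 * η ^ 2 := Nat.mul_le_mul_left _ h2
  have h3 : t ^ 2 * ξ ^ 2 ≤ (t * ξ + i) ^ 2 := by
    rw [← mul_pow]
    exact Nat.pow_le_pow_left (Nat.le_add_right _ _) 2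
  have h4 : t ^ 4 * η ^ 2 ≤ (t ^ 2 * η + j) ^ 2 := by
    rw [show t ^ 4 * η ^ 2 = (t ^ 2 * η) ^ 2 by ring]
    exact Nat.pow_le_pow_left (Nat.le_add_right _ _) 2
  constructor <;> linarith

/-- Strict integer inequalities scale to gaps of at least `t²` or `t⁴`, while a shift by `d` changes
the squares only by `2dξt + d²` or `2dηt² + d²`. -/
theorem eventually_box_outside {ξ η ζ : ℕ} (h : ξ ^ 2 < η ∨ η ^ 2 < ζ) (d : ℕ) :
    ∀ᶠ t : ℕ in atTop, ∀ i j k : ℕ, i ≤ d → j ≤ d → k ≤ d →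
      ¬ (t ^ 2 * η + j < (t * ξ + i) ^ 2 ∧ t ^ 4 * ζ + k < (t ^ 2 * η + j) ^ 2) := by
  filter_upwards [eventually_gt_atTop (2 * d * ξ + 2 * d * η + d ^ 2)] with t ht i j k hi hj hk
  rintro ⟨h1, h2⟩
  have ht1 : 1 ≤ t := by omega
  rcases h with h | h
  · have h3 : (t * ξ + i) ^ 2 ≤ (t * ξ + d) ^ 2 := Nat.pow_le_pow_left (by omega) 2
    have h4 : t ^ 2 * (ξ ^ 2 + 1) ≤ t ^ 2 * η := Nat.mul_le_mul_left _ h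
    have h5 : d ^ 2 ≤ t * d ^ 2 := Nat.le_mul_of_pos_left _ ht1
    have h6 : t * (2 * d * ξ + 2 * d * η + d ^ 2) ≤ t * t := Nat.mul_le_mul_left _ ht.le
    have h7 : 0 ≤ t * (2 * d * η) := Nat.zero_le _
    nlinarith
  · have h3 : (t ^ 2 * η + j) ^ 2 ≤ (t ^ 2 * η + d) ^ 2 := Nat.pow_le_pow_left (by omega) 2
    have h4 : t ^ 4 * (η ^ 2 + 1) ≤ t ^ 4 * ζ := Nat.mul_le_mul_left _ h
    have h5 : d ^ 2 ≤ t ^ 2 * d ^ 2 := Nat.le_mul_of_pos_left _ (by positivity)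
    have h6 : t ^ 2 * (2 * d * ξ + 2 * d * η + d ^ 2) ≤ t ^ 2 * t ^ 2 :=
      Nat.mul_le_mul_left _ (ht.le.trans (Nat.le_self_pow two_ne_zero t))
    have h7 : 0 ≤ t ^ 2 * (2 * d * ξ) := Nat.zero_le _
    nlinarith

/-- The region `y < x²`, `z < y²` is not the positivity set of an exponential polynomial. -/
theorem not_pos_iff_of_algebraic {R : Type*} [Ring R] [Algebra ℝ R] (a b c : R)
    (ha : IsIntegral ℝ a) (hb : IsIntegral ℝ b) (hc : IsIntegral ℝ c) (l : R →ₗ[ℝ] ℝ)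
    (hl : ∀ x y z : ℕ, 0 < l (c ^ z * b ^ y * a ^ x) ↔ y < x ^ 2 ∧ z < y ^ 2) : False := by
  obtain ⟨qa, Ia, Ma, qa0, qan, hIa, hMa⟩ := exists_pow_mul_aeval_eq a ha
  obtain ⟨qb, Ib, Mb, qb0, qbn, hIb, hMb⟩ := exists_pow_mul_aeval_eq b hb
  obtain ⟨qc, Ic, Mc, qc0, qcn, hIc, hMc⟩ := exists_pow_mul_aeval_eq c hc
  -- `g` has two descriptions: an exponential polynomial (`hexp`) and a nonnegative average of `l`
  -- over a box (`hbox`).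
  let g : ℕ → ℕ → ℕ → ℝ := fun x y z =>
    l ((c ^ z * aeval c qc) * (b ^ y * aeval b qb) * (a ^ x * aeval a qa))
  let w : ExpIndex → ℝ := fun j => l (Mc j.2.2 * Mb j.2.1 * Ma j.1)
  let I : Finset ExpIndex := Ia ×ˢ Ib ×ˢ Ic
  have hexp : ∀ x y z, g x y z = ∑ j ∈ I, w j * j.term x y z := by
    intro x y z
    simp only [g, hMa, hMb, hMc, Finset.sum_mul, Finset.mul_sum, map_sum, I, Finset.sum_product,
      smul_mul_assoc, mul_smul_comm, map_smul, smul_eq_mul, w, ExpIndex.term]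
    refine Finset.sum_congr rfl fun i _ => ?_
    refine Finset.sum_congr rfl fun j _ => Finset.sum_congr rfl fun k _ => by ring
  have hpow : ∀ (r : R) (q : ℝ[X]) (x : ℕ), r ^ x * aeval r q =
      ∑ i ∈ Finset.range (q.natDegree + 1), q.coeff i • r ^ (x + i) := by
    intro r q x
    simp only [aeval_eq_sum_range, Finset.mul_sum, mul_smul_comm, pow_add]
  have hbox : ∀ x y z, g x y z = ∑ i ∈ Finset.range (qa.natDegree + 1),
      ∑ j ∈ Finset.range (qb.natDegree + 1), ∑ k ∈ Finset.range (qc.natDegree + 1),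
        qa.coeff i * qb.coeff j * qc.coeff k * l (c ^ (z + k) * b ^ (y + j) * a ^ (x + i)) := by
    intro x y z
    simp only [g, hpow, Finset.sum_mul, Finset.mul_sum, map_sum, smul_mul_assoc, mul_smul_comm,
      map_smul, smul_eq_mul]
    refine Finset.sum_congr rfl fun i _ => ?_
    refine Finset.sum_congr rfl fun j _ => Finset.sum_congr rfl fun k _ => by ring
  let d := qa.natDegree + qb.natDegree + qc.natDegree
  have hcoeff : ∀ i j k, 0 ≤ qa.coeff i * qb.coeff j * qc.coeff k := fun i j k =>
    mul_nonneg (mul_nonneg (qan i) (qbn j)) (qcn k)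
  have hnonneg : ∀ x y z, (∀ i j k, i ≤ d → j ≤ d → k ≤ d →
      y + j < (x + i) ^ 2 ∧ z + k < (y + j) ^ 2) → 0 ≤ g x y z := by
    intro x y z h
    rw [hbox]
    refine Finset.sum_nonneg fun i hi => Finset.sum_nonneg fun j hj => Finset.sum_nonneg fun k hk =>
      mul_nonneg (hcoeff i j k) ((hl _ _ _).2 (h i j k ?_ ?_ ?_)).le
    all_goals simp only [Finset.mem_range, d] at *; omega
  have hnonpos : ∀ x y z, (∀ i j k, i ≤ d → j ≤ d → k ≤ d →
      ¬ (y + j < (x + i) ^ 2 ∧ z + k < (y + j) ^ 2)) → g x y z ≤ 0 := by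
    intro x y z h
    rw [hbox]
    refine Finset.sum_nonpos fun i hi => Finset.sum_nonpos fun j hj => Finset.sum_nonpos fun k hk =>
      mul_nonpos_of_nonneg_of_nonpos (hcoeff i j k)
        (not_lt.1 (mt (hl _ _ _).1 (h i j k ?_ ?_ ?_)))
    all_goals simp only [Finset.mem_range, d] at *; omega
  -- Otherwise `g` vanishes identically, yet the whole box at `(2d+2, d+1, 0)` lies in the region
  -- and its top corner has positive weight.
  have hne : ∃ j ∈ I, w j ≠ 0 := by
    by_contra! h0
    have hz : g (2 * d + 2) (d + 1) 0 = 0 := by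
      rw [hexp]
      exact Finset.sum_eq_zero fun j hj => by rw [h0 j hj, zero_mul]
    have hlead : ∀ q : ℝ[X], q ≠ 0 → (∀ n, 0 ≤ q.coeff n) → 0 < q.coeff q.natDegree :=
      fun q hq hn => lt_of_le_of_ne (hn _) (leadingCoeff_ne_zero.2 hq).symm
    have hin : ∀ i j k, i ≤ d → j ≤ d → k ≤ d →
        d + 1 + j < (2 * d + 2 + i) ^ 2 ∧ 0 + k < (d + 1 + j) ^ 2 := by
      intro i j k _ _ _
      constructor <;> nlinarith
    have hterm : ∀ i ∈ Finset.range (qa.natDegree + 1), ∀ j ∈ Finset.range (qb.natDegree + 1),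
        ∀ k ∈ Finset.range (qc.natDegree + 1), 0 ≤ qa.coeff i * qb.coeff j * qc.coeff k *
          l (c ^ (0 + k) * b ^ (d + 1 + j) * a ^ (2 * d + 2 + i)) := by
      intro i hi j hj k hk
      refine mul_nonneg (hcoeff i j k) ((hl _ _ _).2 (hin i j k ?_ ?_ ?_)).le
      all_goals simp only [Finset.mem_range, d] at *; omega
    rw [hbox, Finset.sum_eq_zero_iff_of_nonneg fun i hi => Finset.sum_nonneg fun j hj =>
      Finset.sum_nonneg fun k hk => hterm i hi j hj k hk] at hz
    have ea := Finset.self_mem_range_succ qa.natDegree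
    have eb := Finset.self_mem_range_succ qb.natDegree
    have ec := Finset.self_mem_range_succ qc.natDegree
    have h1 := hz _ ea
    rw [Finset.sum_eq_zero_iff_of_nonneg fun j hj =>
      Finset.sum_nonneg fun k hk => hterm _ ea j hj k hk] at h1
    have h2 := h1 _ eb
    rw [Finset.sum_eq_zero_iff_of_nonneg fun k hk => hterm _ ea _ eb k hk] at h2
    refine absurd (h2 _ ec) (mul_pos (mul_pos (mul_pos (hlead qa qa0 qan) (hlead qb qb0 qbn))
      (hlead qc qc0 qcn)) ((hl _ _ _).2 (hin _ _ _ ?_ ?_ ?_))).ne'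
    all_goals simp only [d]; omega
  obtain ⟨h, h0, s, hs, hlim⟩ := exists_leading_polynomial I w (fun j hj => by
    simp only [I, Finset.mem_product] at hj
    exact ⟨hIa _ hj.1, hIb _ hj.2.1, hIc _ hj.2.2⟩) hne
  simp only [← hexp] at hlim
  have hrat : ∀ y z : ℚ, 0 < y → 0 < z → ∃ ξ η ζ : ℕ, 0 < ξ ∧ 0 < η ∧ 0 < ζ ∧
      y = η / ξ ^ 2 ∧ z = ζ / ξ ^ 4 := by
    intro y z hy hz
    have hyn : 0 < y.num := Rat.num_pos.2 hy
    have hzn : 0 < z.num := Rat.num_pos.2 hz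
    have hyd := y.den_pos
    have hzd := z.den_pos
    have hy' : y = (y.num.toNat : ℚ) / y.den := by
      conv_lhs => rw [← Rat.num_div_den y]
      congr 1
      exact_mod_cast (Int.toNat_of_nonneg hyn.le).symm
    have hz' : z = (z.num.toNat : ℚ) / z.den := by
      conv_lhs => rw [← Rat.num_div_den z]
      congr 1
      exact_mod_cast (Int.toNat_of_nonneg hzn.le).symm
    have hyt : 0 < y.num.toNat := by omega
    have hzt : 0 < z.num.toNat := by omega
    refine ⟨y.den * z.den, y.num.toNat * y.den * z.den ^ 2, z.num.toNat * y.den ^ 4 * z.den ^ 3,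
      by positivity, by positivity, by positivity, ?_, ?_⟩
    · conv_lhs => rw [hy']
      push_cast
      field_simp
    · conv_lhs => rw [hz']
      push_cast
      field_simp
  refine not_sign_quadrants h h0 ?_ ?_
  · intro y z hy hz hy1 hzy
    obtain ⟨ξ, η, ζ, hξ, hη, hζ, rfl, rfl⟩ := hrat y z hy hz
    push_cast
    refine ge_of_tendsto (hlim ξ η ζ hξ hη hζ) ?_
    have hξ' : (0 : ℚ) < ξ := by exact_mod_cast hξ
    have h1 : η < ξ ^ 2 := by
      rw [div_lt_one (by positivity)] at hy1
      exact_mod_cast hy1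
    have h2 : ζ < η ^ 2 := by
      rw [div_pow, ← pow_mul, div_lt_div_iff_of_pos_right (by positivity)] at hzy
      exact_mod_cast hzy
    filter_upwards [eventually_box_inside h1 h2 d] with t ht
    exact div_nonneg (hnonneg _ _ _ ht) (hs ..)
  · intro y z hy hz hyz
    obtain ⟨ξ, η, ζ, hξ, hη, hζ, rfl, rfl⟩ := hrat y z hy hz
    push_cast
    refine le_of_tendsto (hlim ξ η ζ hξ hη hζ) ?_
    have hξ' : (0 : ℚ) < ξ := by exact_mod_cast hξ
    have h1 : ξ ^ 2 < η ∨ η ^ 2 < ζ := by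
      rw [one_lt_div (by positivity), div_pow, ← pow_mul,
        div_lt_div_iff_of_pos_right (by positivity)] at hyz
      exact_mod_cast hyz
    filter_upwards [eventually_box_outside h1 d] with t ht
    exact div_nonpos_of_nonpos_of_nonneg (hnonpos _ _ _ ht) (hs ..)

theorem PFA.not_recognizes_lapinsWords {E : Type} [Fintype E] [DecidableEq E] (P : PFA ABC E)
    (c : ℝ) : ¬ P.RecognizesWithCutpoint c lapinsWords := by
  intro hP
  obtain ⟨l, hl⟩ := P.exists_linearMap_acceptProb_sub c
  refine not_pos_iff_of_algebraic (P.trans (.sym ABC.a)) (P.trans (.sym ABC.b))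
    (P.trans (.sym ABC.c)) (Algebra.IsIntegral.isIntegral _) (Algebra.IsIntegral.isIntegral _)
    (Algebra.IsIntegral.isIntegral _) l fun x y z => ?_
  -- Matrices act on the left, so `a^x b^y c^z` yields the product `C^z B^y A^x`.
  have h1 := hl (List.replicate x ABC.a ++ List.replicate y ABC.b ++ List.replicate z ABC.c)
  have h2 := hP (List.replicate x ABC.a ++ List.replicate y ABC.b ++ List.replicate z ABC.c)
  have h3 := mem_lapinsWords_iff
    (List.replicate x ABC.a ++ List.replicate y ABC.b ++ List.replicate z ABC.c)
  simp only [List.reverse_append, List.reverse_replicate, List.map_append, List.map_replicate,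
    List.prod_append, List.prod_replicate, ← mul_assoc] at h1
  rw [← h1, sub_pos, ← h2]
  simpa [List.count_replicate] using h3

theorem lapinsLanguage_notMem_SL : lapinsLanguage ∉ SL := by
  rintro ⟨E, _, _, P, c, _, _, hP⟩
  exact PFA.not_recognizes_lapinsWords (E := E) P c hP

theorem mainTheorem2 :
    SL ⊂ AfL ∧
    (∃ (E : Type) (_ : Fintype E) (_ : DecidableEq E) (M : AfA ABC E),
      M.RecognizesWithCutpoint (1 / 2) lapinsWords) ∧
    lapinsLanguage ∉ SL := by
  have hrec : ∃ (E : Type) (_ : Fintype E) (_ : DecidableEq E) (M : AfA ABC E),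
      M.RecognizesWithCutpoint (1 / 2) lapinsWords :=
    ⟨_, inferInstance, inferInstance, _, complete_countTrans_recognizes⟩
  refine ⟨⟨SL_subset_AfL, fun h => lapinsLanguage_notMem_SL (h ?_)⟩, hrec,
    lapinsLanguage_notMem_SL⟩
  obtain ⟨E, i1, i2, M, hM⟩ := hrec
  exact ⟨E, i1, i2, M, 1 / 2, by norm_num, by norm_num, hM⟩
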